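/- Let $(V,\otimes,k)$ be a commutative quantale, i.e. a complete lattice with a commutative monoid structure whose multiplication preserves arbitrary suprema in each variable. Then the following two categories are equivalent: $$\mathrm{Inj}(V)\;\simeq\; V\text{-}\mathtt{Mod}(\mathtt{Quant}).$$ **The category $\mathrm{Inj}(V)$.** A $V$-relation $r:X\nrightarrow Y$ is a map $r:X\times Y\to V$; $V$-relations are ordered pointwise and composed by $(s\circ r)(x,z)=\bigvee_y r(x,y)\otimes s(y,z)$; $r^\circ$ denotes the opposite relation, and a function $f$ is regarded as the relation with value $k$ at $(x,f(x))$ and $\bot$ elsewhere. Let $L$ be the list monad, with unit $e_X(x)=(x)$ and multiplication $m_X$ (concatenation), extended to $V$-relations by $Lr((x_1,\dots,x_n),(y_1,\dots,y_n))=r(x_1,y_1)\otimes\cdots\otimes r(x_n,y_n)$ (with value $k$ if $n=0$), and $\bot$ on lists of different lengths. For $r:LX\nrightarrow Y$ and $s:LY\nrightarrow Z$ put $s\bullet r=s\circ Lr\circ m_X^\circ$. * An $(L,V)$-category is a set $X$ with a relation $a:LX\nrightarrow X$ such that $e_X^\circ\le a$ and $a\bullet a\le a$. * An $(L,V)$-functor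 $f:(X,a)\to(Y,b)$ is a map with $a(\underline x,x)\le b(Lf(\underline x),f(x))$ for all $\underline x\in LX$, $x\in X$. For functors $f,g:(X,a)\to(Y,b)$ write $f\le g$ if $k\le\bigwedge_{x} b((f(x)),g(x))$. An $(L,V)$-category $X$ is separated if $f\le g$ and $g\le f$ imply $f=g$ for all functors $f,g$ into $X$. * An $(L,V)$-distributor from $(X,a)$ to $(Y,b)$ is a relation $j:LX\nrightarrow Y$ with $j\bullet a\le j$ and $b\bullet j\le j$. Each functor $f:(X,a)\to(Y,b)$ gives a distributor $f_\circledast(\underline x,y)=b(Lf(\underline x),y)$. * Given a functor $h:Y\to X$ and a distributor $\varphi$ from $Y$ to $Z$, a functor $g:Z\to X$ is a $\varphi$-weighted colimit of $h$ if, for every distributor $t$ from $Z$ to $X$, $t\le g_\circledast\iff t\bullet\varphi\le h_\circledast$. $X$ is cocomplete if every such pair $(h,\varphi)$ has a weighted colimit; a functor is cocontinuous if it preserves all weighted colimits. $\mathrm{Inj}(V)$ has the cocomplete separated $(L,V)$-categories as objects and the cocontinuous $(L,V)$-functors as arrows. **The category $V\text{-}\mathtt{Mod}(\mathtt{Quant})$.**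 A quantale is a complete lattice with a (not necessarily commutative) monoid structure whose multiplication preserves suprema in each variable; a morphism of quantales is a supremum-preserving monoid homomorphism. For complete lattices $X,Y$ let $X\otimes_2Y$ be their tensor product as suplattices, i.e. the complete lattice, ordered by inclusion, of those $C\subseteq X\times Y$ such that for all $A\subseteq X$, $B\subseteq Y$: $A\times B\subseteq C\iff(\bigvee A,\bigvee B)\in C$; let $x\otimes y$ be the least element of $X\otimes_2 Y$ containing $(x,y)$. For quantales $X,Y$ it carries the unit $k_X\otimes k_Y$ and the supremum-preserving multiplication with $(x\otimes y)(x'\otimes y')=xx'\otimes yy'$. An object of $V\text{-}\mathtt{Mod}(\mathtt{Quant})$ is a quantale $Q$ (the one-element quantale is allowed) with a supremum-preserving map $\rho:V\otimes_2Q\to Q$ that is an action, $\rho(k\otimes q)=q$ and $\rho((v\otimes w)\otimes q)=\rho(v\otimes\rho(w\otimes q))$, and a monoid homomorphism. Its arrows are the morphisms of quantales $f:(Q,\rho)\to(R,\theta)$ that are equivariant: $f(\rho(v\otimes q))=\theta(v\otimes f(q))$. -/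

import Mathlib

open CategoryTheory

universe u

namespace QMulti

/-! ### Relations with values in a quantale -/

section Relations

variable (V : Type u) [CommMonoid V] [CompleteLattice V] [IsQuantale V]

/-- A `V`-relation from `X` to `Y`, ordered pointwise. -/
abbrev VRel (X Y : Type u) : Type u := X → Y → V

variable {V}

/-- The composite `s ∘ r` ("matrix multiplication"): first `r`, then `s`. -/
def VRel.comp {X Y Z : Type u} (s : VRel V Y Z) (r : VRel V X Y) : VRel V X Z :=
  fun x z => ⨆ y, r x y * s y z

/-- The opposite relation `r°`. -/
def VRel.conv {X Y : Type u} (r : VRel V X Y) : VRel V Y X :=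
  fun y x => r x y

open Classical in
/-- A function seen as a `V`-relation. -/
noncomputable def VRel.graph {X Y : Type u} (f : X → Y) : VRel V X Y :=
  fun x y => if f x = y then 1 else ⊥

/-- The extension of the list functor to `V`-relations: it takes `(x₁, …, xₙ)` and `(y₁, …, yₙ)` to
`r(x₁, y₁) ⊗ … ⊗ r(xₙ, yₙ)`, and two lists of different lengths to `⊥`. -/
def VRel.list {X Y : Type u} (r : VRel V X Y) : VRel V (List X) (List Y)
  | [], [] => 1
  | x :: xs, y :: ys => r x y * VRel.list r xs ys
  | [], _ :: _ => ⊥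
  | _ :: _, [] => ⊥

/-- The `(L,V)`-relation `e°`, where `e` is the unit `x ↦ (x)` of the list monad. -/
noncomputable def unitRel (X : Type u) : VRel V (List X) X :=
  VRel.conv (VRel.graph fun x : X => [x])

/-- The Kleisli composite `s • r = s ∘ L r ∘ m°` of `(L,V)`-relations, where `m` is the
multiplication (concatenation of a list of lists) of the list monad. -/
noncomputable def kcomp {X Y Z : Type u} (s : VRel V (List Y) Z) (r : VRel V (List X) Y) :
    VRel V (List X) Z :=
  VRel.comp s (VRel.comp (VRel.list r)
    (VRel.conv (VRel.graph (List.flatten : List (List X) → List X))))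

end Relations

/-! ### `(L,V)`-categories, functors and distributors -/

section Multicategories

/-- An `(L,V)`-category (a quantale-enriched multicategory). -/
structure LVCat (V : Type u) [CommMonoid V] [CompleteLattice V] [IsQuantale V] where
  carrier : Type u
  str : VRel V (List carrier) carrier
  unit_le : unitRel carrier ≤ str
  comp_le : kcomp str str ≤ str

variable {V : Type u} [CommMonoid V] [CompleteLattice V] [IsQuantale V]

/-- An `(L,V)`-functor. -/
@[ext]
structure LVFunctor (X Y : LVCat V) where
  toFun : X.carrier → Y.carrier
  str_le : ∀ (xs : List X.carrier) (x : X.carrier),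
    X.str xs x ≤ Y.str (xs.map toFun) (toFun x)

/-- The identity `(L,V)`-functor. -/
def LVFunctor.id (X : LVCat V) : LVFunctor X X where
  toFun := fun x => x
  str_le := fun xs x => by simp

/-- The composite of `(L,V)`-functors: first `f`, then `g`. -/
def LVFunctor.comp {X Y Z : LVCat V} (g : LVFunctor Y Z) (f : LVFunctor X Y) : LVFunctor X Z where
  toFun := fun x => g.toFun (f.toFun x)
  str_le := fun xs x => by
    have h := (f.str_le xs x).trans (g.str_le _ _)
    rwa [List.map_map] at h

/-- The preorder on `(L,V)`-functors. -/
def LVFunctor.Below {X Y : LVCat V} (f g : LVFunctor X Y) : Prop :=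
  1 ≤ ⨅ x : X.carrier, Y.str ([x].map f.toFun) (g.toFun x)

/-- An `(L,V)`-category is separated if equivalent functors into it are equal. -/
def LVCat.IsSeparated (X : LVCat V) : Prop :=
  ∀ (Y : LVCat V) (f g : LVFunctor Y X), f.Below g → g.Below f → f = g

/-- `(L,V)`-distributors from `X` to `Y`. -/
structure IsDistributor (X Y : LVCat V) (j : VRel V (List X.carrier) Y.carrier) : Prop where
  comp_str_le : kcomp j X.str ≤ j
  str_comp_le : kcomp Y.str j ≤ j

/-- The distributor `f_⊛` from `X` to `Y` induced by an `(L,V)`-functor `f` from `X` to `Y`. -/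
def LVFunctor.lower {X Y : LVCat V} (f : LVFunctor X Y) : VRel V (List X.carrier) Y.carrier :=
  fun xs y => Y.str (xs.map f.toFun) y

/-- `g : Z ⟶ X` is a colimit of `h : Y ⟶ X` weighted by the distributor `φ` from `Y` to `Z`:
the distributor `g_⊛` is the right extension of `h_⊛` along `φ`, that is, the largest
distributor `t` from `Z` to `X` with `t • φ ≤ h_⊛`. -/
def IsColimit {X Y Z : LVCat V} (φ : VRel V (List Y.carrier) Z.carrier)
    (h : LVFunctor Y X) (g : LVFunctor Z X) : Prop :=
  ∀ t : VRel V (List Z.carrier) X.carrier, IsDistributor Z X t →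
    (t ≤ g.lower ↔ kcomp t φ ≤ h.lower)

/-- An `(L,V)`-category is cocomplete if all weighted colimits exist in it. -/
def LVCat.IsCocomplete (X : LVCat V) : Prop :=
  ∀ (Y Z : LVCat V) (φ : VRel V (List Y.carrier) Z.carrier), IsDistributor Y Z φ →
    ∀ h : LVFunctor Y X, ∃ g : LVFunctor Z X, IsColimit φ h g

/-- An `(L,V)`-functor is cocontinuous if it preserves all weighted colimits. -/
def LVFunctor.IsCocontinuous {X X' : LVCat V} (f : LVFunctor X X') : Prop :=
  ∀ (Y Z : LVCat V) (φ : VRel V (List Y.carrier) Z.carrier), IsDistributor Y Z φ →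
    ∀ (h : LVFunctor Y X) (g : LVFunctor Z X),
      IsColimit φ h g → IsColimit φ (f.comp h) (f.comp g)

end Multicategories

/-- Cocomplete separated `(L,V)`-categories. -/
structure CocoSep (V : Type u) [CommMonoid V] [CompleteLattice V] [IsQuantale V] where
  toLVCat : LVCat V
  separated : toLVCat.IsSeparated
  cocomplete : toLVCat.IsCocomplete

/-- Cocontinuous `(L,V)`-functors between cocomplete separated `(L,V)`-categories. -/
@[ext]
structure CocoSep.Hom {V : Type u} [CommMonoid V] [CompleteLattice V] [IsQuantale V]
    (X Y : CocoSep V) where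
  toLVFunctor : LVFunctor X.toLVCat Y.toLVCat
  cocontinuous : toLVFunctor.IsCocontinuous

/-- The category of cocomplete separated `(L,V)`-categories and cocontinuous `(L,V)`-functors. -/
instance CocoSep.category (V : Type u) [CommMonoid V] [CompleteLattice V] [IsQuantale V] :
    Category (CocoSep V) where
  Hom X Y := CocoSep.Hom X Y
  id X := ⟨LVFunctor.id X.toLVCat, fun _ _ _ _ _ _ hg => hg⟩
  comp f g := ⟨g.toLVFunctor.comp f.toLVFunctor, fun Y Z φ hφ h k hk =>
    g.cocontinuous Y Z φ hφ _ _ (f.cocontinuous Y Z φ hφ h k hk)⟩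

/-! ### The tensor product of suplattices -/

section Tensor

variable {X Y : Type u} [CompleteLattice X] [CompleteLattice Y]

/-- The subsets of `X × Y` that are elements of the tensor product of the suplattices `X`, `Y`. -/
def IsTensorClosed (C : Set (X × Y)) : Prop :=
  ∀ (A : Set X) (B : Set Y), A ×ˢ B ⊆ C ↔ (sSup A, sSup B) ∈ C

/-- The least tensor-closed subset that contains a given one. -/
def tensorClosure (S : Set (X × Y)) : Set (X × Y) :=
  ⋂₀ {C | IsTensorClosed C ∧ S ⊆ C}

theorem isTensorClosed_tensorClosure (S : Set (X × Y)) : IsTensorClosed (tensorClosure S) := by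
  intro A B
  constructor
  · intro h C hC
    exact (hC.1 A B).1 fun p hp => h hp C hC
  · intro h p hp C hC
    exact (hC.1 A B).2 (h C hC) hp

variable (X Y) in
/-- The tensor product of suplattices, ordered by inclusion. -/
def SupTensor : Type u := {C : Set (X × Y) // IsTensorClosed C}

instance : PartialOrder (SupTensor X Y) :=
  inferInstanceAs (PartialOrder {C : Set (X × Y) // IsTensorClosed C})

/-- The supremum of a family of tensor-closed sets is the closure of their union. -/
instance : SupSet (SupTensor X Y) where
  sSup 𝒮 := ⟨tensorClosure (⋃ C ∈ 𝒮, C.1), isTensorClosed_tensorClosure _⟩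

theorem isLUB_sSup_supTensor (𝒮 : Set (SupTensor X Y)) : IsLUB 𝒮 (sSup 𝒮) := by
  constructor
  · intro C hC p hp D hD
    exact hD.2 (Set.mem_biUnion hC hp)
  · intro D hD p hp
    exact hp D.1 ⟨D.2, Set.iUnion₂_subset fun C hC => hD hC⟩

/-- The pure tensor of `x` and `y`. -/
def tmul (x : X) (y : Y) : SupTensor X Y :=
  ⟨tensorClosure {(x, y)}, isTensorClosed_tensorClosure _⟩

/-- The unit `k ⊗ k` of the tensor product of two quantales. -/
instance [Monoid X] [Monoid Y] : One (SupTensor X Y) where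
  one := tmul 1 1

/-- The multiplication of the tensor product of two quantales: the one that preserves suprema in
each variable and satisfies `(x ⊗ y) * (x' ⊗ y') = (x * x') ⊗ (y * y')`. -/
instance [Monoid X] [Monoid Y] : Mul (SupTensor X Y) where
  mul C D := ⟨tensorClosure {r | ∃ p ∈ C.1, ∃ q ∈ D.1, r = (p.1 * q.1, p.2 * q.2)},
    isTensorClosed_tensorClosure _⟩

end Tensor

/-! ### Quantales with an action -/

/-- Quantales `Q` equipped with an action `ρ : V ⊗ Q ⟶ Q` in suplattices that is a homomorphism of
monoids. -/
structure VModQuant (V : Type u) [CommMonoid V] [CompleteLattice V] [IsQuantale V] where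
  carrier : Type u
  [monoid : Monoid carrier]
  [lattice : CompleteLattice carrier]
  [quantale : IsQuantale carrier]
  act : sSupHom (SupTensor V carrier) carrier
  one_act : ∀ q : carrier, act (tmul 1 q) = q
  mul_act : ∀ (v w : V) (q : carrier), act (tmul (v * w) q) = act (tmul v (act (tmul w q)))
  act_one : act 1 = 1
  act_mul : ∀ s t : SupTensor V carrier, act (s * t) = act s * act t

attribute [instance] VModQuant.monoid VModQuant.lattice VModQuant.quantale

/-- Equivariant morphisms of quantales. -/
@[ext]
structure VModQuant.Hom {V : Type u} [CommMonoid V] [CompleteLattice V] [IsQuantale V]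
    (Q R : VModQuant V) where
  toFun : Q.carrier → R.carrier
  map_sSup : ∀ s : Set Q.carrier, toFun (sSup s) = sSup (toFun '' s)
  map_one : toFun 1 = 1
  map_mul : ∀ x y : Q.carrier, toFun (x * y) = toFun x * toFun y
  map_act : ∀ (v : V) (x : Q.carrier), toFun (Q.act (tmul v x)) = R.act (tmul v (toFun x))

/-- The category of quantales with a `V`-action that is a monoid homomorphism, and equivariant
morphisms of quantales. -/
instance VModQuant.category (V : Type u) [CommMonoid V] [CompleteLattice V] [IsQuantale V] :
    Category (VModQuant V) where
  Hom Q R := VModQuant.Hom Q R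
  id Q := ⟨fun x => x, fun s => by simp, rfl, fun _ _ => rfl, fun _ _ => rfl⟩
  comp f g := ⟨fun x => g.toFun (f.toFun x),
    fun s => by rw [f.map_sSup, g.map_sSup, Set.image_image],
    by rw [f.map_one, g.map_one],
    fun x y => by rw [f.map_mul, g.map_mul],
    fun v x => by rw [f.map_act, g.map_act]⟩

end QMulti

/-!
The equivalence is realised by the functor that sends a quantale `Q` with an action of `V` to the
`(L,V)`-category on `Q` whose structure is `a(xs, y) = hom(x₁ * … * xₙ, y)`, where `hom(x, y)` is
the largest scalar `v` with `v • x ≤ y`. A map `g` into it is the colimit of `h` weighted by `φ`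
exactly when `g z` is the supremum over `ys` of `φ(ys, z) • h y₁ * … * h yₘ`: the product of
several such suprema is again one, weighted by the list extension of `φ` (`prod_map_wsup`), so this
map represents the right extension (`kcomp_le_lower_iff`). Hence `Q` is cocomplete, and morphisms of
quantales with an action, which preserve such suprema, are cocontinuous.

The functor is full because products, scalar multiples and suprema in `Q` are all colimits of the
identity of the discrete category on `Q`, weighted by relations to the one-point discrete category;
a cocontinuous functor therefore preserves them (`map_wsup_of_isCocontinuous`).

It is essentially surjective, indeed surjective on objects. For a weight `ψ` on the lists of points
of a cocomplete separated `X`, a colimit indexed by a single point only determines relations out of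
lists of copies of that point. So the colimit is taken over the discrete category on `Option X`,
with the old points weighted by themselves and the new point by `ψ`. Separation forces the old
points to go to themselves, and the new one goes to a point `c` such that, in any context of old
points, `a(zs ++ [c] ++ ws, x)` is the infimum over `ys` of the residuals of
`a(zs ++ ys ++ ws, x)` by `ψ ys` (`LVCat.exists_le_str_iff`). Indicators of a list, scalar multiples
of singletons and indicators of sets of singletons give the product, the action and the suprema on
`X`, and the compatibility with contexts gives all axioms. Since `c` is determined by the relation
it represents, each axiom is an equality of such relations.
-/

namespace QMulti

open Quantale

/-! ### The list extension and Kleisli composition -/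

section Relations

variable {V : Type u} [CommMonoid V] [CompleteLattice V]

@[simp]
theorem VRel.list_nil_nil {X Y : Type u} (r : VRel V X Y) : VRel.list r [] [] = 1 := rfl

@[simp]
theorem VRel.list_cons_cons {X Y : Type u} (r : VRel V X Y) (x : X) (xs : List X) (y : Y)
    (ys : List Y) : VRel.list r (x :: xs) (y :: ys) = r x y * VRel.list r xs ys := rfl

@[simp]
theorem VRel.list_nil_cons {X Y : Type u} (r : VRel V X Y) (y : Y) (ys : List Y) :
    VRel.list r [] (y :: ys) = ⊥ := rfl

@[simp]
theorem VRel.list_cons_nil {X Y : Type u} (r : VRel V X Y) (x : X) (xs : List X) :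
    VRel.list r (x :: xs) [] = ⊥ := rfl

theorem VRel.list_map_left {W X Y : Type u} (f : W → X) (r : VRel V X Y) (ws : List W)
    (ys : List Y) : VRel.list r (ws.map f) ys = VRel.list (fun w y => r (f w) y) ws ys := by
  induction ws generalizing ys with
  | nil => cases ys <;> simp
  | cons w ws ih => cases ys <;> simp [ih]

theorem VRel.list_map_right {X Y Z : Type u} (f : Z → Y) (r : VRel V X Y) (xs : List X)
    (zs : List Z) : VRel.list r xs (zs.map f) = VRel.list (fun x z => r x (f z)) xs zs := by
  induction zs generalizing xs with
  | nil => cases xs <;> simp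
  | cons z zs ih => cases xs <;> simp [ih]

theorem unitRel_singleton {X : Type u} (x : X) : (unitRel X : VRel V (List X) X) [x] x = 1 := by
  simp [unitRel, VRel.conv, VRel.graph]

theorem unitRel_le_iff {X : Type u} {r : VRel V (List X) X} :
    unitRel X ≤ r ↔ ∀ x, 1 ≤ r [x] x := by
  constructor
  · intro h x
    rw [← unitRel_singleton]
    exact h [x] x
  · intro h xs x
    simp only [unitRel, VRel.conv, VRel.graph]
    split_ifs with hx
    · subst hx
      exact h x
    · exact bot_le

variable [IsQuantale V]

theorem VRel.list_mono {X Y : Type u} {r s : VRel V X Y} (h : ∀ x y, r x y ≤ s x y)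
    (xs : List X) (ys : List Y) : VRel.list r xs ys ≤ VRel.list s xs ys := by
  induction xs generalizing ys with
  | nil => cases ys <;> simp
  | cons x xs ih =>
    cases ys with
    | nil => simp
    | cons y ys => exact mul_le_mul' (h x y) (ih ys)

/-- Lax functoriality of the list extension, in a form adapted to residuals. -/
theorem VRel.list_mul_list_le {X Y Z : Type u} {r : VRel V X Y} {s : VRel V Y Z} {t : VRel V X Z}
    (h : ∀ x y z, s y z * r x y ≤ t x z) (xs : List X) (ys : List Y) (zs : List Z) :
    VRel.list s ys zs * VRel.list r xs ys ≤ VRel.list t xs zs := by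
  induction xs generalizing ys zs with
  | nil => cases ys <;> cases zs <;> simp
  | cons x xs ih =>
    cases ys with
    | nil => simp
    | cons y ys =>
      cases zs with
      | nil => simp
      | cons z zs =>
        rw [list_cons_cons, list_cons_cons, list_cons_cons, mul_mul_mul_comm]
        exact mul_le_mul' (h x y z) (ih ys zs)

/-- Only lists cut in the same way contribute: a value other than `⊥` at `xs` and `ys ++ zs`
comes from a splitting of `xs`. -/
theorem VRel.list_append_right {X Y : Type u} (r : VRel V X Y) (xs : List X) (ys zs : List Y) :
    VRel.list r xs (ys ++ zs) = ⊥ ∨ ∃ us vs, xs = us ++ vs ∧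
      VRel.list r xs (ys ++ zs) = VRel.list r us ys * VRel.list r vs zs := by
  induction ys generalizing xs with
  | nil => exact Or.inr ⟨[], xs, rfl, by simp⟩
  | cons y ys ih =>
    cases xs with
    | nil => simp
    | cons x xs =>
      rcases ih xs with h | ⟨us, vs, rfl, h⟩
      · left
        rw [List.cons_append, list_cons_cons, h, mul_bot]
      · refine Or.inr ⟨x :: us, vs, rfl, ?_⟩
        rw [List.cons_append, list_cons_cons, h, list_cons_cons, mul_assoc]

theorem VRel.list_flatten_right {X Y : Type u} (r : VRel V X Y) (xs : List X)
    (yss : List (List Y)) :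
    VRel.list r xs yss.flatten = ⊥ ∨ ∃ xss : List (List X), xs = xss.flatten ∧
      VRel.list r xs yss.flatten = VRel.list (VRel.list r) xss yss := by
  induction yss generalizing xs with
  | nil =>
    cases xs with
    | nil => exact Or.inr ⟨[], rfl, rfl⟩
    | cons x xs => exact Or.inl rfl
  | cons ys yss ih =>
    rw [List.flatten_cons]
    rcases VRel.list_append_right r xs ys yss.flatten with h | ⟨us, vs, rfl, h⟩
    · exact Or.inl h
    · rw [h]
      rcases ih vs with h' | ⟨vss, rfl, h'⟩
      · left
        rw [h', mul_bot]
      · refine Or.inr ⟨us :: vss, rfl, ?_⟩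
        rw [h', VRel.list_cons_cons]

theorem kcomp_le_iff {X Y Z : Type u} {s : VRel V (List Y) Z} {r : VRel V (List X) Y}
    {t : VRel V (List X) Z} :
    kcomp s r ≤ t ↔ ∀ xss ys z, VRel.list r xss ys * s ys z ≤ t xss.flatten z := by
  simp only [Pi.le_def, kcomp, VRel.comp, VRel.conv, VRel.graph, iSup_mul_distrib, iSup_le_iff]
  constructor
  · intro h xss ys z
    simpa using h xss.flatten z ys xss
  · intro h xs z ys xss
    split_ifs with hx
    · subst hx
      simpa using h xss ys z
    · simp

theorem list_unitRel {X : Type u} (xss : List (List X)) (xs : List X) :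
    VRel.list (unitRel X : VRel V (List X) X) xss xs = ⊥ ∨
      xss.flatten = xs ∧ VRel.list (unitRel X : VRel V (List X) X) xss xs = 1 := by
  induction xss generalizing xs with
  | nil => cases xs <;> simp
  | cons ys xss ih =>
    cases xs with
    | nil => simp
    | cons x xs =>
      by_cases hx : [x] = ys
      · subst hx
        rw [VRel.list_cons_cons, unitRel_singleton, one_mul, List.flatten_cons]
        simpa using ih xs
      · left
        rw [VRel.list_cons_cons]
        simp [unitRel, VRel.conv, VRel.graph, hx]

theorem kcomp_unitRel_le {X Y : Type u} (r : VRel V (List X) Y) : kcomp r (unitRel X) ≤ r := by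
  rw [kcomp_le_iff]
  intro xss xs y
  rcases list_unitRel (V := V) xss xs with h | ⟨rfl, h⟩ <;> simp [h]

theorem unitRel_kcomp_le {X Y : Type u} (r : VRel V (List X) Y) : kcomp (unitRel Y) r ≤ r := by
  rw [kcomp_le_iff]
  intro xss ys y
  simp only [unitRel, VRel.conv, VRel.graph]
  split_ifs with hy
  · subst hy
    rcases xss with _ | ⟨xs, _ | ⟨xs', xss⟩⟩ <;> simp
  · simp

end Relations

/-! ### Functors, distributors and right extensions -/

section Multicategories

variable {V : Type u} [CommMonoid V] [CompleteLattice V] [IsQuantale V]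

theorem LVCat.one_le_str (X : LVCat V) (x : X.carrier) : 1 ≤ X.str [x] x :=
  unitRel_le_iff.1 X.unit_le x

theorem LVCat.list_str_mul_str_le (X : LVCat V) (xss : List (List X.carrier))
    (xs : List X.carrier) (x : X.carrier) :
    VRel.list X.str xss xs * X.str xs x ≤ X.str xss.flatten x :=
  kcomp_le_iff.1 X.comp_le xss xs x

theorem LVCat.str_mul_str_le (X : LVCat V) (xs : List X.carrier) (y z : X.carrier) :
    X.str xs y * X.str [y] z ≤ X.str xs z := by
  simpa using X.list_str_mul_str_le [xs] [y] z

/-- The discrete `(L,V)`-category on a set. -/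
noncomputable abbrev LVCat.discrete (V : Type u) [CommMonoid V] [CompleteLattice V] [IsQuantale V]
    (X : Type u) : LVCat V where
  carrier := X
  str := unitRel X
  unit_le := le_rfl
  comp_le := kcomp_unitRel_le _

/-- Every map out of a discrete `(L,V)`-category is a functor. -/
def LVFunctor.ofDiscrete {A : Type u} {X : LVCat V} (f : A → X.carrier) :
    LVFunctor (LVCat.discrete V A) X where
  toFun := f
  str_le := by
    have h : (unitRel A : VRel V (List A) A) ≤ fun xs x => X.str (xs.map f) (f x) :=
      unitRel_le_iff.2 fun x => X.one_le_str (f x)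
    exact h

theorem isDistributor_discrete {A B : Type u} (φ : VRel V (List A) B) :
    IsDistributor (LVCat.discrete V A) (LVCat.discrete V B) φ :=
  ⟨kcomp_unitRel_le φ, unitRel_kcomp_le φ⟩

theorem LVFunctor.isDistributor_lower {X Y : LVCat V} (f : LVFunctor X Y) :
    IsDistributor X Y f.lower where
  comp_str_le := by
    rw [kcomp_le_iff]
    intro xss xs y
    have h := Y.list_str_mul_str_le (xss.map (List.map f.toFun)) (xs.map f.toFun) y
    rw [← List.map_flatten, VRel.list_map_left, VRel.list_map_right] at h
    exact (mul_le_mul_left (VRel.list_mono (fun xs x => f.str_le xs x) _ _) _).trans h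
  str_comp_le := by
    rw [kcomp_le_iff]
    intro xss ys y
    have h := Y.list_str_mul_str_le (xss.map (List.map f.toFun)) ys y
    rwa [← List.map_flatten, VRel.list_map_left] at h

theorem IsColimit.unique {X Y Z : LVCat V} (hX : X.IsSeparated)
    {φ : VRel V (List Y.carrier) Z.carrier} {h : LVFunctor Y X} {g g' : LVFunctor Z X}
    (hg : IsColimit φ h g) (hg' : IsColimit φ h g') : g = g' := by
  have key : ∀ {g g' : LVFunctor Z X}, IsColimit φ h g → IsColimit φ h g' → g.Below g' := by
    intro g g' hg hg'
    have hle : g'.lower ≤ g.lower :=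
      (hg _ g'.isDistributor_lower).2 ((hg' _ g'.isDistributor_lower).1 le_rfl)
    exact le_iInf fun z => (X.one_le_str _).trans (hle [z] (g'.toFun z))
  exact hX Z g g' (key hg hg') (key hg' hg)

/-- The right extension of `h_⊛` along a relation `φ`, where `h` is a map to an
`(L,V)`-category. -/
def rightExt {A B : Type u} (X : LVCat V) (φ : VRel V (List A) B) (h : A → X.carrier) :
    VRel V (List B) X.carrier :=
  fun bs x => ⨅ ass, VRel.list φ ass bs ⇨ₗ X.str (ass.flatten.map h) x

theorem le_rightExt_iff {A B : Type u} {X : LVCat V} {φ : VRel V (List A) B} {h : A → X.carrier}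
    {v : V} {bs : List B} {x : X.carrier} :
    v ≤ rightExt X φ h bs x ↔
      ∀ ass, v * VRel.list φ ass bs ≤ X.str (ass.flatten.map h) x := by
  simp only [rightExt, le_iInf_iff, leftMulResiduation_le_iff_mul_le]

theorem isDistributor_rightExt {A B : Type u} (X : LVCat V) (φ : VRel V (List A) B)
    (h : A → X.carrier) : IsDistributor (LVCat.discrete V B) X (rightExt X φ h) where
  comp_str_le := kcomp_unitRel_le _
  str_comp_le := by
    rw [kcomp_le_iff]
    intro bss xs x
    refine le_rightExt_iff.2 fun ass => ?_
    -- A list of lists over the concatenation of `bss` is cut into blocks along `bss`.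
    rcases VRel.list_flatten_right φ ass bss with h0 | ⟨asss, rfl, h1⟩
    · rw [h0, mul_bot]
      exact bot_le
    · rw [h1, mul_right_comm]
      have h2 := X.list_str_mul_str_le (asss.map fun ass => ass.flatten.map h) xs x
      rw [VRel.list_map_left] at h2
      have h3 : (asss.map fun ass => ass.flatten.map h).flatten = asss.flatten.flatten.map h := by
        rw [List.flatten_flatten, List.map_flatten, List.map_map]
        rfl
      rw [h3] at h2
      exact (mul_le_mul_left (VRel.list_mul_list_le
        (fun ass bs y => le_rightExt_iff.1 le_rfl ass) asss bss xs) _).trans h2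

/-- A colimit weighted by a relation between discrete `(L,V)`-categories is computed by the
right extension. -/
theorem IsColimit.lower_eq {A B : Type u} {X : LVCat V} {φ : VRel V (List A) B}
    {h : LVFunctor (LVCat.discrete V A) X} {g : LVFunctor (LVCat.discrete V B) X}
    (hg : IsColimit φ h g) : g.lower = rightExt X φ h.toFun := by
  apply le_antisymm
  · have h1 := kcomp_le_iff.1 ((hg _ g.isDistributor_lower).1 le_rfl)
    intro bs x
    refine le_rightExt_iff.2 fun ass => ?_
    rw [mul_comm]
    exact h1 ass bs x
  · rw [hg _ (isDistributor_rightExt X φ h.toFun), kcomp_le_iff]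
    intro ass bs x
    rw [mul_comm]
    exact le_rightExt_iff.1 le_rfl ass

end Multicategories

/-! ### Maps out of a tensor product of suplattices -/

section Tensor

variable {X Y : Type u} [CompleteLattice X] [CompleteLattice Y]

theorem subset_tensorClosure (S : Set (X × Y)) : S ⊆ tensorClosure S :=
  Set.subset_sInter fun _ hC => hC.2

theorem tensorClosure_subset_iff {S C : Set (X × Y)} (hC : IsTensorClosed C) :
    tensorClosure S ⊆ C ↔ S ⊆ C :=
  ⟨(subset_tensorClosure S).trans, fun h => Set.sInter_subset_of_mem ⟨hC, h⟩⟩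

theorem tmul_le_iff {x : X} {y : Y} {C : SupTensor X Y} : tmul x y ≤ C ↔ (x, y) ∈ C.1 :=
  (tensorClosure_subset_iff C.2).trans Set.singleton_subset_iff

theorem sSup_tmul (s : Set X) (y : Y) :
    (tmul (sSup s) y : SupTensor X Y) = sSup ((fun x => tmul x y) '' s) := by
  refine IsLUB.unique (s := (fun x => (tmul x y : SupTensor X Y)) '' s) ?_
    (isLUB_sSup_supTensor _)
  rw [isLUB_iff_le_iff]
  intro C
  have h := C.2 s {y}
  rw [sSup_singleton] at h
  rw [tmul_le_iff, ← h, mem_upperBounds, Set.forall_mem_image]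
  simp only [tmul_le_iff]
  exact ⟨fun h x hx => h ⟨hx, rfl⟩, fun h p hp => by
    obtain ⟨x, z⟩ := p
    obtain ⟨hx, rfl⟩ := hp
    exact h hx⟩

theorem tmul_sSup (x : X) (s : Set Y) :
    (tmul x (sSup s) : SupTensor X Y) = sSup ((fun y => tmul x y) '' s) := by
  refine IsLUB.unique (s := (fun y => (tmul x y : SupTensor X Y)) '' s) ?_
    (isLUB_sSup_supTensor _)
  rw [isLUB_iff_le_iff]
  intro C
  have h := C.2 {x} s
  rw [sSup_singleton] at h
  rw [tmul_le_iff, ← h, mem_upperBounds, Set.forall_mem_image]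
  simp only [tmul_le_iff]
  exact ⟨fun h y hy => h ⟨rfl, hy⟩, fun h p hp => by
    obtain ⟨z, y⟩ := p
    obtain ⟨rfl, hy⟩ := hp
    exact h hy⟩

theorem tmul_mul_tmul [Monoid X] [Monoid Y] [IsQuantale X] [IsQuantale Y] (x x' : X) (y y' : Y) :
    (tmul x y * tmul x' y' : SupTensor X Y) = tmul (x * x') (y * y') := by
  -- Translations are suplattice maps in each variable, so they pull tensor-closed sets back.
  have hl : ∀ (p : X × Y) {C : Set (X × Y)}, IsTensorClosed C →
      IsTensorClosed {q : X × Y | (p.1 * q.1, p.2 * q.2) ∈ C} := by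
    intro p C hC A B
    have h := hC ((p.1 * ·) '' A) ((p.2 * ·) '' B)
    rw [sSup_image, sSup_image, ← mul_sSup_distrib, ← mul_sSup_distrib] at h
    refine Iff.trans ⟨?_, ?_⟩ h
    · rintro h ⟨_, _⟩ ⟨⟨a, ha, rfl⟩, ⟨b, hb, rfl⟩⟩
      exact h (show (a, b) ∈ A ×ˢ B from ⟨ha, hb⟩)
    · rintro h ⟨a, b⟩ ⟨ha, hb⟩
      exact h ⟨⟨a, ha, rfl⟩, ⟨b, hb, rfl⟩⟩
  have hr : ∀ (p : X × Y) {C : Set (X × Y)}, IsTensorClosed C →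
      IsTensorClosed {q : X × Y | (q.1 * p.1, q.2 * p.2) ∈ C} := by
    intro p C hC A B
    have h := hC ((· * p.1) '' A) ((· * p.2) '' B)
    rw [sSup_image, sSup_image, ← sSup_mul_distrib, ← sSup_mul_distrib] at h
    refine Iff.trans ⟨?_, ?_⟩ h
    · rintro h ⟨_, _⟩ ⟨⟨a, ha, rfl⟩, ⟨b, hb, rfl⟩⟩
      exact h (show (a, b) ∈ A ×ˢ B from ⟨ha, hb⟩)
    · rintro h ⟨a, b⟩ ⟨ha, hb⟩
      exact h ⟨⟨a, ha, rfl⟩, ⟨b, hb, rfl⟩⟩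
  apply le_antisymm
  · refine (tensorClosure_subset_iff (tmul (x * x') (y * y')).2).2 ?_
    rintro _ ⟨p, hp, q, hq, rfl⟩
    have h1 : ∀ q ∈ (tmul x' y').1, (x * q.1, y * q.2) ∈ (tmul (x * x') (y * y')).1 :=
      (tensorClosure_subset_iff (hl (x, y) (tmul (x * x') (y * y')).2)).2
        (Set.singleton_subset_iff.2 (subset_tensorClosure _ rfl))
    exact (tensorClosure_subset_iff (hr q (tmul (x * x') (y * y')).2)).2
      (Set.singleton_subset_iff.2 (h1 q hq)) hp
  · exact tmul_le_iff.2 (subset_tensorClosure _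
      ⟨(x, y), subset_tensorClosure _ rfl, (x', y'), subset_tensorClosure _ rfl, rfl⟩)

variable {Z : Type u} [CompleteLattice Z]

theorem isTensorClosed_setOf_le {β : X → Y → Z}
    (hl : ∀ (s : Set X) (y : Y), β (sSup s) y = ⨆ x ∈ s, β x y)
    (hr : ∀ (x : X) (s : Set Y), β x (sSup s) = ⨆ y ∈ s, β x y) (z : Z) :
    IsTensorClosed {p : X × Y | β p.1 p.2 ≤ z} := by
  intro A B
  simp only [Set.mem_ofPred_eq, hl, hr, iSup_le_iff]
  exact ⟨fun h a ha b hb => h (show (a, b) ∈ A ×ˢ B from ⟨ha, hb⟩),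
    fun h p hp => h p.1 hp.1 p.2 hp.2⟩

/-- The suplattice map out of the tensor product that is induced by a map which preserves suprema
in each variable. -/
def SupTensor.lift (β : X → Y → Z)
    (hl : ∀ (s : Set X) (y : Y), β (sSup s) y = ⨆ x ∈ s, β x y)
    (hr : ∀ (x : X) (s : Set Y), β x (sSup s) = ⨆ y ∈ s, β x y) :
    sSupHom (SupTensor X Y) Z where
  toFun C := ⨆ p ∈ C.1, β p.1 p.2
  map_sSup' := by
    intro 𝒮
    refine eq_of_forall_ge_iff fun z => ?_
    rw [sSup_image]
    simp only [iSup_le_iff]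
    refine (tensorClosure_subset_iff (S := ⋃ C ∈ 𝒮, C.1)
      (isTensorClosed_setOf_le hl hr z)).trans ?_
    rw [Set.iUnion₂_subset_iff]
    rfl

theorem SupTensor.lift_le_iff (β : X → Y → Z) (hl hr) (S : Set (X × Y)) {z : Z} :
    SupTensor.lift β hl hr ⟨tensorClosure S, isTensorClosed_tensorClosure S⟩ ≤ z ↔
      ∀ p ∈ S, β p.1 p.2 ≤ z :=
  iSup₂_le_iff.trans (tensorClosure_subset_iff (isTensorClosed_setOf_le hl hr z))

theorem SupTensor.lift_tmul (β : X → Y → Z) (hl hr)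
    (x : X) (y : Y) : SupTensor.lift β hl hr (tmul x y) = β x y :=
  eq_of_forall_ge_iff fun z => (SupTensor.lift_le_iff β hl hr {(x, y)}).trans (by simp)

end Tensor

/-! ### The multicategory of a quantale with an action -/

section Quant

variable {V : Type u} [CommMonoid V] [CompleteLattice V] [IsQuantale V]

namespace VModQuant

/-- The action of a scalar on an element of a quantale with an action. -/
def smul (Q : VModQuant V) (v : V) (q : Q.carrier) : Q.carrier := Q.act (tmul v q)

variable (Q : VModQuant V)

theorem one_smul (q : Q.carrier) : Q.smul 1 q = q := Q.one_act q

theorem mul_smul (v w : V) (q : Q.carrier) : Q.smul (v * w) q = Q.smul v (Q.smul w q) :=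
  Q.mul_act v w q

theorem smul_mul_smul (v w : V) (q r : Q.carrier) :
    Q.smul v q * Q.smul w r = Q.smul (v * w) (q * r) := by
  rw [smul, smul, smul, ← Q.act_mul, tmul_mul_tmul]

theorem sSup_smul (s : Set V) (q : Q.carrier) : Q.smul (sSup s) q = ⨆ v ∈ s, Q.smul v q := by
  rw [smul, sSup_tmul, map_sSup, Set.image_image, sSup_image]
  rfl

theorem smul_sSup (v : V) (s : Set Q.carrier) : Q.smul v (sSup s) = ⨆ q ∈ s, Q.smul v q := by
  rw [smul, tmul_sSup, map_sSup, Set.image_image, sSup_image]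
  rfl

theorem smul_iSup {ι : Type*} (v : V) (f : ι → Q.carrier) :
    Q.smul v (⨆ i, f i) = ⨆ i, Q.smul v (f i) := by
  rw [iSup, smul_sSup, iSup_range]

theorem smul_mono {v w : V} {q r : Q.carrier} (hv : v ≤ w) (hq : q ≤ r) :
    Q.smul v q ≤ Q.smul w r := by
  have h1 := Q.sSup_smul {v, w} r
  have h2 := Q.smul_sSup v {q, r}
  rw [sSup_pair, iSup_pair, sup_eq_right.2 hv] at h1
  rw [sSup_pair, iSup_pair, sup_eq_right.2 hq] at h2
  exact (sup_eq_right.1 h2.symm).trans (sup_eq_right.1 h1.symm)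

@[simp]
theorem bot_smul (q : Q.carrier) : Q.smul ⊥ q = ⊥ := by
  rw [← sSup_empty, sSup_smul]
  simp

/-- The `V`-valued hom of a quantale with an action. -/
def hom (q r : Q.carrier) : V := sSup {v | Q.smul v q ≤ r}

variable {Q}

theorem le_hom_iff {v : V} {q r : Q.carrier} : v ≤ Q.hom q r ↔ Q.smul v q ≤ r := by
  refine ⟨fun h => (Q.smul_mono h le_rfl).trans ?_, fun h => le_sSup h⟩
  rw [hom, sSup_smul]
  exact iSup₂_le fun _ hw => hw

theorem hom_smul_le (q r : Q.carrier) : Q.smul (Q.hom q r) q ≤ r := le_hom_iff.1 le_rfl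

theorem list_hom_smul_prod_le (qss : List (List Q.carrier)) (qs : List Q.carrier) :
    Q.smul (VRel.list (fun ps q => Q.hom ps.prod q) qss qs) qss.flatten.prod ≤ qs.prod := by
  induction qss generalizing qs with
  | nil => cases qs <;> simp [Q.one_smul]
  | cons ps qss ih =>
    cases qs with
    | nil => simp
    | cons q qs =>
      rw [VRel.list_cons_cons, List.flatten_cons, List.prod_append, ← smul_mul_smul,
        List.prod_cons]
      exact mul_le_mul' (hom_smul_le _ _) (ih qs)

variable (Q)

/-- The `(L,V)`-category of a quantale with an action: the value at `(q₁, …, qₙ)` and `r` is the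
hom from `q₁ * … * qₙ` to `r`. -/
@[reducible]
def toLVCat : LVCat V where
  carrier := Q.carrier
  str qs r := Q.hom qs.prod r
  unit_le := unitRel_le_iff.2 fun q => le_hom_iff.2 (by simp [one_smul])
  comp_le := by
    rw [kcomp_le_iff]
    intro qss qs r
    rw [le_hom_iff, mul_comm, mul_smul]
    exact (Q.smul_mono le_rfl (list_hom_smul_prod_le qss qs)).trans (hom_smul_le _ _)

theorem isSeparated_toLVCat : Q.toLVCat.IsSeparated := by
  have key : ∀ {Y : LVCat V} {f g : LVFunctor Y Q.toLVCat}, f.Below g →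
      ∀ y, f.toFun y ≤ g.toFun y := by
    intro Y f g h y
    have h1 := le_hom_iff.1 (le_iInf_iff.1 h y)
    simpa [one_smul] using h1
  intro Y f g hfg hgf
  exact LVFunctor.ext (funext fun y => le_antisymm (key hfg y) (key hgf y))

variable {A B : Type u}

/-- The supremum of the products `h a₁ * … * h aₙ` weighted by `φ`. -/
def wsup (φ : VRel V (List A) B) (h : A → Q.carrier) (b : B) : Q.carrier :=
  ⨆ as, Q.smul (φ as b) (as.map h).prod

theorem prod_map_wsup (φ : VRel V (List A) B) (h : A → Q.carrier) (bs : List B) :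
    (bs.map (Q.wsup φ h)).prod =
      ⨆ ass, Q.smul (VRel.list φ ass bs) (ass.flatten.map h).prod := by
  induction bs with
  | nil =>
    refine le_antisymm (le_iSup_of_le [] (by simp [one_smul])) (iSup_le fun ass => ?_)
    cases ass <;> simp [one_smul]
  | cons b bs ih =>
    rw [List.map_cons, List.prod_cons, ih, wsup, iSup_mul_distrib]
    simp only [mul_iSup_distrib, smul_mul_smul]
    apply le_antisymm
    · exact iSup_le fun as => iSup_le fun ass => le_iSup_of_le (as :: ass) (by simp)
    · refine iSup_le fun ass => ?_
      cases ass with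
      | nil => simp
      | cons as ass => exact le_iSup_of_le as (le_iSup_of_le ass (by simp))

/-- The map `wsup φ h` represents the right extension of `h_⊛` along `φ`. -/
theorem kcomp_le_lower_iff {φ : VRel V (List A) B} {h : A → Q.carrier}
    {t : VRel V (List B) Q.carrier} :
    kcomp t φ ≤ (fun as q => Q.hom (as.map h).prod q) ↔
      ∀ bs q, t bs q ≤ Q.hom (bs.map (Q.wsup φ h)).prod q := by
  rw [kcomp_le_iff]
  simp only [le_hom_iff, prod_map_wsup, smul_iSup, iSup_le_iff, ← mul_smul]
  constructor
  · intro H bs q ass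
    rw [mul_comm]
    exact H ass bs q
  · intro H ass bs q
    rw [mul_comm]
    exact H bs q ass

variable {Q}

/-- The functor `wsup φ h`, where `φ` is a distributor. -/
def wsupFunctor {Y Z : LVCat V} {φ : VRel V (List Y.carrier) Z.carrier} (hφ : IsDistributor Y Z φ)
    (h : LVFunctor Y Q.toLVCat) : LVFunctor Z Q.toLVCat where
  toFun := Q.wsup φ h.toFun
  str_le zs z := by
    rw [le_hom_iff, prod_map_wsup, smul_iSup]
    refine iSup_le fun yss => ?_
    rw [← mul_smul, mul_comm]
    exact le_iSup_of_le yss.flatten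
      (Q.smul_mono (kcomp_le_iff.1 hφ.str_comp_le yss zs z) le_rfl)

theorem isColimit_wsupFunctor {Y Z : LVCat V} {φ : VRel V (List Y.carrier) Z.carrier}
    (hφ : IsDistributor Y Z φ) (h : LVFunctor Y Q.toLVCat) :
    IsColimit φ h (wsupFunctor hφ h) :=
  fun _ _ => Q.kcomp_le_lower_iff.symm

variable (Q)

/-- The cocomplete separated `(L,V)`-category of a quantale with an action. -/
def toCocoSep : CocoSep V where
  toLVCat := Q.toLVCat
  separated := Q.isSeparated_toLVCat
  cocomplete := fun _ _ _ hφ h => ⟨wsupFunctor hφ h, isColimit_wsupFunctor hφ h⟩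

variable {Q} {R : VModQuant V}

theorem eq_wsup_of_isColimit {Y Z : LVCat V} {φ : VRel V (List Y.carrier) Z.carrier}
    (hφ : IsDistributor Y Z φ) {h : LVFunctor Y Q.toLVCat} {g : LVFunctor Z Q.toLVCat}
    (hg : IsColimit φ h g) : g.toFun = Q.wsup φ h.toFun := by
  rw [hg.unique Q.isSeparated_toLVCat (isColimit_wsupFunctor hφ h)]
  rfl

/-! ### Morphisms of quantales are cocontinuous functors -/

namespace Hom

theorem map_smul (f : Hom Q R) (v : V) (q : Q.carrier) :
    f.toFun (Q.smul v q) = R.smul v (f.toFun q) := f.map_act v q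

theorem map_iSup (f : Hom Q R) {ι : Type*} (g : ι → Q.carrier) :
    f.toFun (⨆ i, g i) = ⨆ i, f.toFun (g i) := by
  rw [iSup, f.map_sSup, ← Set.range_comp]
  rfl

theorem mono (f : Hom Q R) {q r : Q.carrier} (h : q ≤ r) : f.toFun q ≤ f.toFun r := by
  have h1 := f.map_sSup {q, r}
  rw [sSup_pair, Set.image_pair, sSup_pair, sup_eq_right.2 h] at h1
  exact sup_eq_right.1 h1.symm

theorem map_prod (f : Hom Q R) (qs : List Q.carrier) :
    f.toFun qs.prod = (qs.map f.toFun).prod := by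
  induction qs with
  | nil => exact f.map_one
  | cons q qs ih => rw [List.prod_cons, f.map_mul, ih, List.map_cons, List.prod_cons]

theorem map_wsup (f : Hom Q R) (φ : VRel V (List A) B) (h : A → Q.carrier) (b : B) :
    f.toFun (Q.wsup φ h b) = R.wsup φ (fun a => f.toFun (h a)) b := by
  rw [wsup, map_iSup]
  simp only [map_smul, map_prod, List.map_map]
  rfl

/-- The functor of `(L,V)`-categories given by an equivariant morphism of quantales. -/
def toLVFunctor (f : Hom Q R) : LVFunctor Q.toLVCat R.toLVCat where
  toFun := f.toFun
  str_le qs r := by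
    rw [le_hom_iff, ← map_prod, ← map_smul]
    exact f.mono (hom_smul_le _ _)

theorem isCocontinuous_toLVFunctor (f : Hom Q R) : f.toLVFunctor.IsCocontinuous := by
  intro Y Z φ hφ h g hg
  have h1 : f.toLVFunctor.comp g = wsupFunctor hφ (f.toLVFunctor.comp h) := by
    apply LVFunctor.ext
    funext z
    exact (congrArg f.toFun (congrFun (eq_wsup_of_isColimit hφ hg) z)).trans
      (f.map_wsup φ h.toFun z)
  rw [h1]
  exact isColimit_wsupFunctor _ _

end Hom

/-- A cocontinuous functor preserves weighted suprema of products of elements. -/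
theorem map_wsup_of_isCocontinuous {f : LVFunctor Q.toLVCat R.toLVCat} (hf : f.IsCocontinuous)
    (φ : VRel V (List Q.carrier) PUnit.{u + 1}) :
    f.toFun (⨆ qs, Q.smul (φ qs ⟨⟩) qs.prod) =
      ⨆ qs, R.smul (φ qs ⟨⟩) (qs.map f.toFun).prod := by
  have hφ := isDistributor_discrete φ
  have h1 := hf (LVCat.discrete V Q.carrier) (LVCat.discrete V PUnit) φ hφ _ _
    (isColimit_wsupFunctor hφ (LVFunctor.ofDiscrete (X := Q.toLVCat) fun q => q))
  have h := congrFun (eq_wsup_of_isColimit hφ h1) ⟨⟩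
  simpa [LVFunctor.comp, wsupFunctor, wsup, LVFunctor.ofDiscrete] using h

/-- The multiplication, the unit and the action are the cases of the list `[x, y]`, of the empty
list and of a one-element list. -/
theorem map_smul_prod_of_isCocontinuous {f : LVFunctor Q.toLVCat R.toLVCat}
    (hf : f.IsCocontinuous) (v : V) (qs : List Q.carrier) :
    f.toFun (Q.smul v qs.prod) = R.smul v (qs.map f.toFun).prod := by
  have h := map_wsup_of_isCocontinuous hf (fun ps _ => ⨆ _ : ps = qs, v)
  have key : ∀ (P : VModQuant V) (g : List Q.carrier → P.carrier),
      ⨆ ps, P.smul (⨆ _ : ps = qs, v) (g ps) = P.smul v (g qs) := by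
    intro P g
    refine le_antisymm (iSup_le fun ps => ?_) (le_iSup_of_le qs (by simp))
    by_cases hp : ps = qs <;> simp [hp]
  rwa [key Q, key R] at h

theorem map_sSup_of_isCocontinuous {f : LVFunctor Q.toLVCat R.toLVCat}
    (hf : f.IsCocontinuous) (s : Set Q.carrier) : f.toFun (sSup s) = sSup (f.toFun '' s) := by
  have h := map_wsup_of_isCocontinuous hf (fun ps _ => ⨆ _ : ∃ q ∈ s, ps = [q], 1)
  have key : ∀ (P : VModQuant V) (g : Q.carrier → P.carrier),
      ⨆ ps : List Q.carrier, P.smul (⨆ _ : ∃ q ∈ s, ps = [q], 1) (ps.map g).prod =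
        ⨆ q ∈ s, g q := by
    intro P g
    apply le_antisymm
    · refine iSup_le fun ps => ?_
      by_cases hp : ∃ q ∈ s, ps = [q]
      · obtain ⟨q, hq, rfl⟩ := hp
        exact le_iSup₂_of_le q hq (by simp [hq, P.one_smul])
      · simp [hp]
    · exact iSup₂_le fun q hq => le_iSup_of_le [q] (by simp [hq, P.one_smul])
  have h1 := key Q fun q => q
  simp only [List.map_id_fun', id] at h1
  rw [h1, key R] at h
  rwa [sSup_eq_iSup, sSup_image]

/-- Every cocontinuous functor between the `(L,V)`-categories of quantales with an action is given
by an equivariant morphism of quantales. -/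
def Hom.ofCocontinuous {f : LVFunctor Q.toLVCat R.toLVCat} (hf : f.IsCocontinuous) : Hom Q R where
  toFun := f.toFun
  map_sSup := map_sSup_of_isCocontinuous hf
  map_one := by simpa [one_smul] using map_smul_prod_of_isCocontinuous hf 1 []
  map_mul x y := by simpa [one_smul] using map_smul_prod_of_isCocontinuous hf 1 [x, y]
  map_act v x := by simpa [smul] using map_smul_prod_of_isCocontinuous hf v [x]

end VModQuant

end Quant

variable {V : Type u} [CommMonoid V] [CompleteLattice V] [IsQuantale V]

/-! ### Suprema of weights in a cocomplete separated multicategory -/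

section Adjoin

variable {A : Type u}

/-- The relation to `Option A` that relates each element of `A` to itself, as a one-element list,
and lists to the new element with weight `ψ`. -/
noncomputable def adjoin (ψ : List A → V) : VRel V (List A) (Option A)
  | as, some a => unitRel A as a
  | as, none => ψ as

omit [IsQuantale V] in
theorem list_adjoin_map_some (ψ : List A → V) (ass : List (List A)) (bs : List A) :
    VRel.list (adjoin ψ) ass (bs.map some) = VRel.list (unitRel A) ass bs :=
  VRel.list_map_right _ _ _ _

/-- The fibre of the list extension of `adjoin ψ` over a list with exactly one new entry: the old
entries can only be matched by singletons, so the lists involved differ from the context by a single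
list, weighted by `ψ`. -/
theorem list_adjoin (ψ : List A → V) (ass : List (List A)) (bs cs : List A) :
    VRel.list (adjoin ψ) ass (bs.map some ++ none :: cs.map some) = ⊥ ∨
      ∃ as, ass.flatten = bs ++ as ++ cs ∧
        VRel.list (adjoin ψ) ass (bs.map some ++ none :: cs.map some) = ψ as := by
  rcases VRel.list_append_right (adjoin ψ) ass (bs.map some) (none :: cs.map some) with
    h | ⟨us, vs, rfl, h⟩
  · exact Or.inl h
  · rw [h, list_adjoin_map_some]
    rcases list_unitRel (V := V) us bs with h1 | ⟨rfl, h1⟩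
    · simp [h1]
    · cases vs with
      | nil => simp
      | cons as vs =>
        rw [VRel.list_cons_cons, list_adjoin_map_some]
        rcases list_unitRel (V := V) vs cs with h2 | ⟨rfl, h2⟩
        · simp [h2]
        · exact Or.inr ⟨as, by simp, by simp [h1, h2, adjoin]⟩

omit [IsQuantale V] in
theorem list_adjoin_singletons (ψ : List A → V) (as bs cs : List A) :
    VRel.list (adjoin ψ) (bs.map (fun b => [b]) ++ as :: cs.map (fun c => [c]))
      (bs.map some ++ none :: cs.map some) = ψ as := by
  have hs : ∀ a : A, adjoin ψ [a] (some a) = 1 := fun a => unitRel_singleton a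
  have hc : VRel.list (adjoin ψ) (cs.map (fun c => [c])) (cs.map some) = 1 := by
    induction cs with
    | nil => rfl
    | cons c cs ih => simp [ih, hs]
  induction bs with
  | nil => simp [hc, adjoin]
  | cons b bs ih => simpa [hs] using ih

end Adjoin

namespace LVCat

variable {X : LVCat V}

theorem IsSeparated.eq_of_one_le_str (hX : X.IsSeparated) {x y : X.carrier}
    (h : 1 ≤ X.str [x] y) (h' : 1 ≤ X.str [y] x) : x = y := by
  have h1 := hX (discrete V PUnit) (LVFunctor.ofDiscrete fun _ => x)
    (LVFunctor.ofDiscrete fun _ => y) (le_iInf fun _ => h) (le_iInf fun _ => h')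
  exact congrFun (congrArg LVFunctor.toFun h1) ⟨⟩

/-- In a separated `(L,V)`-category a point is determined by the relation that it represents. -/
theorem IsSeparated.eq_of_le_str_iff (hX : X.IsSeparated) {x y : X.carrier}
    (h : ∀ v z, v ≤ X.str [x] z ↔ v ≤ X.str [y] z) : x = y :=
  hX.eq_of_one_le_str ((h 1 y).2 (X.one_le_str y)) ((h 1 x).1 (X.one_le_str x))

/-- In a cocomplete separated `(L,V)`-category every weight `ψ` on lists of points has a
supremum that is compatible with concatenation on both sides. -/
theorem exists_le_str_iff (hs : X.IsSeparated) (hc : X.IsCocomplete) (ψ : List X.carrier → V) :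
    ∃ c : X.carrier, ∀ v zs ws x,
      v ≤ X.str (zs ++ c :: ws) x ↔ ∀ ys, v * ψ ys ≤ X.str (zs ++ ys ++ ws) x := by
  -- The colimit of the identity weighted by `adjoin ψ`: the old points keep the list context
  -- available, and the new one becomes the supremum.
  obtain ⟨γ, key⟩ : ∃ γ : Option X.carrier → X.carrier, ∀ v bs x,
      v ≤ X.str (bs.map γ) x ↔
        ∀ ass, v * VRel.list (adjoin ψ) ass bs ≤ X.str ass.flatten x := by
    obtain ⟨g, hg⟩ := hc (discrete V X.carrier) (discrete V (Option X.carrier))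
      (adjoin ψ) (isDistributor_discrete _) (LVFunctor.ofDiscrete fun x => x)
    refine ⟨g.toFun, fun v bs x => ?_⟩
    have h := (congrArg (v ≤ ·) (congrFun (congrFun hg.lower_eq bs) x)).to_iff.trans
      le_rightExt_iff
    simpa [LVFunctor.ofDiscrete, LVFunctor.lower] using h
  have hsome : ∀ x, γ (some x) = x := by
    refine fun x => hs.eq_of_le_str_iff fun v z => (key v [some x] z).trans ?_
    have h1 := fun ass => list_adjoin_map_some ψ ass [x]
    simp only [List.map_cons, List.map_nil] at h1
    simp only [h1]
    constructor
    · intro h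
      simpa [unitRel_singleton] using h [[x]]
    · intro h ass
      rcases list_unitRel (V := V) ass [x] with h2 | ⟨h3, h2⟩
      · simp [h2]
      · simpa [h2, h3] using h
  have hmap : ∀ xs : List X.carrier, (xs.map some).map γ = xs := by simp [Function.comp_def, hsome]
  refine ⟨γ none, fun v zs ws x => ?_⟩
  have h := key v (zs.map some ++ none :: ws.map some) x
  rw [List.map_append, List.map_cons, hmap, hmap] at h
  refine h.trans ⟨fun H ys => ?_, fun H ass => ?_⟩
  · have h1 := H (zs.map (fun z => [z]) ++ ys :: ws.map (fun w => [w]))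
    have h2 : ∀ xs : List X.carrier, (xs.map fun x => [x]).flatten = xs := by
      intro xs
      induction xs with
      | nil => rfl
      | cons x xs ih => simp [ih]
    rwa [list_adjoin_singletons, List.flatten_append, List.flatten_cons, h2, h2,
      ← List.append_assoc] at h1
  · rcases list_adjoin ψ ass zs ws with h0 | ⟨as, h1, h2⟩
    · simp [h0]
    · rw [h1, h2]
      exact H as

end LVCat

/-! ### The quantale of a cocomplete separated multicategory -/

theorem mul_biSup_distrib {Q ι : Type*} [Semigroup Q] [CompleteLattice Q] [IsQuantale Q] (x : Q)
    (s : Set ι) (f : ι → Q) : x * ⨆ i ∈ s, f i = ⨆ i ∈ s, x * f i := by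
  rw [← sSup_image, mul_sSup_distrib, iSup_image]

theorem biSup_mul_distrib {Q ι : Type*} [Semigroup Q] [CompleteLattice Q] [IsQuantale Q] (x : Q)
    (s : Set ι) (f : ι → Q) : (⨆ i ∈ s, f i) * x = ⨆ i ∈ s, f i * x := by
  rw [← sSup_image, sSup_mul_distrib, iSup_image]

/-- The supremum over a proposition encodes a weight that is `w` where `p` holds and `⊥`
elsewhere. -/
theorem mul_iSup_prop_le_iff {p : Prop} {v w z : V} :
    (v * ⨆ _ : p, w) ≤ z ↔ (p → v * w ≤ z) := by
  by_cases h : p <;> simp [h]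

theorem CocoSep.eq_of_toLVCat_eq {X Y : CocoSep V} (h : X.toLVCat = Y.toLVCat) : X = Y := by
  cases X
  cases Y
  cases h
  rfl

theorem LVCat.mk_congr {A : Type u} {a b : VRel V (List A) A} (h : a = b) (ha ha' hb hb') :
    (⟨A, a, ha, ha'⟩ : LVCat V) = ⟨A, b, hb, hb'⟩ := by
  cases h
  rfl

namespace CocoSep

/-- The points of a cocomplete separated `(L,V)`-category, as the carrier of a quantale. -/
def Point (X : CocoSep V) : Type u := X.toLVCat.carrier

/-- The structure of a cocomplete separated `(L,V)`-category. -/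
def str (X : CocoSep V) : VRel V (List X.Point) X.Point := X.toLVCat.str

variable (X : CocoSep V)

theorem exists_le_str_iff (ψ : List X.Point → V) :
    ∃ c : X.Point, ∀ v zs ws x,
      v ≤ X.str (zs ++ c :: ws) x ↔ ∀ ys, v * ψ ys ≤ X.str (zs ++ ys ++ ws) x :=
  LVCat.exists_le_str_iff X.separated X.cocomplete ψ

/-- The supremum of a weight on lists of points. -/
noncomputable def colim (ψ : List X.Point → V) : X.Point := (X.exists_le_str_iff ψ).choose

variable {X}

theorem le_str_colim_iff {ψ : List X.Point → V} {v : V} {zs ws : List X.Point} {x : X.Point} :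
    v ≤ X.str (zs ++ X.colim ψ :: ws) x ↔ ∀ ys, v * ψ ys ≤ X.str (zs ++ ys ++ ws) x :=
  (X.exists_le_str_iff ψ).choose_spec v zs ws x

variable (X)

/-- The product of a list of points, which represents the list. -/
noncomputable def tensor (xs : List X.Point) : X.Point := X.colim fun ys => ⨆ _ : ys = xs, 1

/-- The copower of a point by a scalar. -/
noncomputable def copower (v : V) (x : X.Point) : X.Point := X.colim fun ys => ⨆ _ : ys = [x], v

/-- The supremum of a set of points. -/
noncomputable def sup (s : Set X.Point) : X.Point := X.colim fun ys => ⨆ _ : ∃ x ∈ s, ys = [x], 1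

variable {X}

theorem str_tensor (zs xs ws : List X.Point) (x : X.Point) :
    X.str (zs ++ X.tensor xs :: ws) x = X.str (zs ++ xs ++ ws) x := by
  refine eq_of_forall_le_iff fun v => le_str_colim_iff.trans ?_
  simp only [mul_iSup_prop_le_iff, mul_one, forall_eq]

theorem le_str_copower_iff {v w : V} {zs ws : List X.Point} {x y : X.Point} :
    w ≤ X.str (zs ++ X.copower v x :: ws) y ↔ w * v ≤ X.str (zs ++ x :: ws) y := by
  refine le_str_colim_iff.trans ?_
  simp only [mul_iSup_prop_le_iff, forall_eq, List.append_assoc, List.singleton_append]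

theorem le_str_sup_iff {w : V} {s : Set X.Point} {zs ws : List X.Point} {y : X.Point} :
    w ≤ X.str (zs ++ X.sup s :: ws) y ↔ ∀ x ∈ s, w ≤ X.str (zs ++ x :: ws) y := by
  refine le_str_colim_iff.trans ?_
  simp only [mul_iSup_prop_le_iff, mul_one]
  constructor
  · intro h x hx
    simpa using h [x] ⟨x, hx, rfl⟩
  · rintro h _ ⟨x, hx, rfl⟩
    simpa using h x hx

/-- The underlying order: `x ≤ y` when the unit of `V` is below the value at `(x)` and `y`. -/
instance : PartialOrder X.Point where
  le x y := 1 ≤ X.str [x] y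
  le_refl := X.toLVCat.one_le_str
  le_trans x y z h h' := (one_mul (1 : V)).symm.le.trans
    ((mul_le_mul' h h').trans (X.toLVCat.str_mul_str_le [x] y z))
  le_antisymm _ _ := X.separated.eq_of_one_le_str

theorem le_iff {x y : X.Point} : x ≤ y ↔ 1 ≤ X.str [x] y := Iff.rfl

noncomputable instance : SupSet X.Point := ⟨X.sup⟩

theorem le_str_sSup_iff {w : V} {s : Set X.Point} {zs ws : List X.Point} {y : X.Point} :
    w ≤ X.str (zs ++ sSup s :: ws) y ↔ ∀ x ∈ s, w ≤ X.str (zs ++ x :: ws) y := le_str_sup_iff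

noncomputable instance : CompleteLattice X.Point :=
  completeLatticeOfSup X.Point fun _ => isLUB_iff_le_iff.2 fun _ =>
    le_str_sSup_iff (zs := []) (ws := [])

noncomputable instance : Mul X.Point := ⟨fun x y => X.tensor [x, y]⟩

noncomputable instance : One X.Point := ⟨X.tensor []⟩

theorem str_mul (zs ws : List X.Point) (x y z : X.Point) :
    X.str (zs ++ x * y :: ws) z = X.str (zs ++ x :: y :: ws) z := by
  exact (str_tensor zs [x, y] ws z).trans (by simp)

theorem str_one (zs ws : List X.Point) (z : X.Point) :
    X.str (zs ++ 1 :: ws) z = X.str (zs ++ ws) z := by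
  exact (str_tensor zs [] ws z).trans (by simp)

theorem eq_of_str_eq {x y : X.Point} (h : ∀ z, X.str [x] z = X.str [y] z) : x = y :=
  X.separated.eq_of_le_str_iff fun v z => (congrArg (v ≤ ·) (h z)).to_iff

noncomputable instance : Monoid X.Point where
  one_mul x := eq_of_str_eq fun z => (str_mul [] [] 1 x z).trans (str_one [] [x] z)
  mul_one x := eq_of_str_eq fun z => (str_mul [] [] x 1 z).trans (str_one [x] [] z)
  mul_assoc x y z := eq_of_str_eq fun w =>
    (str_mul [] [] (x * y) z w).trans ((str_mul [] [z] x y w).trans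
      ((str_mul [x] [] y z w).symm.trans (str_mul [] [] x (y * z) w).symm))

theorem str_prod (zs xs : List X.Point) (y : X.Point) :
    X.str (zs ++ [xs.prod]) y = X.str (zs ++ xs) y := by
  induction xs generalizing zs with
  | nil => simpa using str_one zs [] y
  | cons x xs ih =>
    rw [List.prod_cons, str_mul]
    simpa using ih (zs ++ [x])

instance : IsQuantale X.Point where
  mul_sSup_distrib x s := by
    refine eq_of_forall_ge_iff fun z => ?_
    simp only [iSup_le_iff, le_iff]
    have h := fun y => str_mul [] [] x y z
    simp only [List.nil_append] at h
    simp only [h]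
    exact le_str_sSup_iff (zs := [x]) (ws := [])
  sSup_mul_distrib s y := by
    refine eq_of_forall_ge_iff fun z => ?_
    simp only [iSup_le_iff, le_iff]
    have h := fun x => str_mul [] [] x y z
    simp only [List.nil_append] at h
    simp only [h]
    exact le_str_sSup_iff (zs := []) (ws := [y])

theorem copower_le_iff {v : V} {x y : X.Point} : X.copower v x ≤ y ↔ v ≤ X.str [x] y := by
  rw [le_iff]
  refine (le_str_copower_iff (zs := []) (ws := [])).trans ?_
  rw [one_mul]
  rfl

theorem copower_sSup (v : V) (s : Set X.Point) :
    X.copower v (sSup s) = ⨆ x ∈ s, X.copower v x := by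
  refine eq_of_forall_ge_iff fun z => ?_
  simp only [iSup_le_iff, copower_le_iff]
  exact le_str_sSup_iff (zs := []) (ws := [])

theorem sSup_copower (s : Set V) (x : X.Point) :
    X.copower (sSup s) x = ⨆ v ∈ s, X.copower v x := by
  refine eq_of_forall_ge_iff fun z => ?_
  simp only [iSup_le_iff, copower_le_iff, sSup_le_iff]

theorem one_copower (x : X.Point) : X.copower 1 x = x :=
  eq_of_forall_ge_iff fun _ => copower_le_iff

theorem mul_copower (v w : V) (x : X.Point) :
    X.copower (v * w) x = X.copower v (X.copower w x) := by
  refine eq_of_forall_ge_iff fun z => ?_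
  rw [copower_le_iff, copower_le_iff]
  exact (le_str_copower_iff (zs := []) (ws := [])).symm

theorem copower_mul_copower (v w : V) (x y : X.Point) :
    X.copower v x * X.copower w y = X.copower (v * w) (x * y) := by
  refine eq_of_forall_ge_iff fun z => ?_
  have h1 := str_mul [] [] (X.copower v x) (X.copower w y) z
  have h2 := str_mul [] [] x y z
  simp only [List.nil_append] at h1 h2
  rw [copower_le_iff, h2, le_iff, h1]
  refine (le_str_copower_iff (zs := []) (ws := [X.copower w y])).trans ?_
  rw [one_mul]
  exact le_str_copower_iff (zs := [x]) (ws := [])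

variable (X)

/-- The quantale with an action that underlies a cocomplete separated `(L,V)`-category. -/
noncomputable def toVModQuant : VModQuant V where
  carrier := X.Point
  act := SupTensor.lift X.copower sSup_copower copower_sSup
  one_act x := by rw [SupTensor.lift_tmul, one_copower]
  mul_act v w x := by
    rw [SupTensor.lift_tmul, SupTensor.lift_tmul, SupTensor.lift_tmul, mul_copower]
  act_one := (SupTensor.lift_tmul _ _ _ _ _).trans (one_copower 1)
  act_mul s t := by
    refine eq_of_forall_ge_iff fun z => (SupTensor.lift_le_iff _ _ _ _).trans ?_
    change _ ↔ (⨆ p ∈ s.1, X.copower p.1 p.2) * (⨆ q ∈ t.1, X.copower q.1 q.2) ≤ z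
    simp only [biSup_mul_distrib, mul_biSup_distrib, iSup_le_iff, copower_mul_copower]
    constructor
    · intro h q hq p hp
      exact h _ ⟨p, hp, q, hq, rfl⟩
    · rintro h _ ⟨p, hp, q, hq, rfl⟩
      exact h q hq p hp

theorem hom_prod_toVModQuant (xs : List X.Point) (y : X.Point) :
    X.toVModQuant.hom xs.prod y = X.str xs y := by
  refine eq_of_forall_le_iff fun v => VModQuant.le_hom_iff.trans ?_
  have h : X.toVModQuant.smul v xs.prod = X.copower v xs.prod :=
    SupTensor.lift_tmul X.copower sSup_copower copower_sSup v xs.prod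
  rw [h]
  refine copower_le_iff.trans ?_
  rw [← List.nil_append [xs.prod], str_prod]
  rfl

/-- Every cocomplete separated `(L,V)`-category comes from a quantale with an action. The equality
holds on the nose, since `toVModQuant` keeps the set of points. -/
theorem toCocoSep_toVModQuant : X.toVModQuant.toCocoSep = X :=
  eq_of_toLVCat_eq (LVCat.mk_congr (A := X.Point) (b := X.str)
    (funext fun xs => funext fun y => X.hom_prod_toVModQuant xs y) _ _ _ _)

end CocoSep

/-! ### The equivalence -/

/-- The functor `Q ↦ (Q, hom(x₁ * … * xₙ, y))` from quantales with an action to cocomplete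
separated `(L,V)`-categories. -/
def VModQuant.toCocoSepFunctor (V : Type u) [CommMonoid V] [CompleteLattice V] [IsQuantale V] :
    VModQuant V ⥤ CocoSep V where
  obj Q := Q.toCocoSep
  map f := ⟨Hom.toLVFunctor f, Hom.isCocontinuous_toLVFunctor f⟩
  map_id _ := rfl
  map_comp _ _ := rfl

instance : (VModQuant.toCocoSepFunctor V).Faithful where
  map_injective {Q R _ _} h := VModQuant.Hom.ext
    (congrArg (fun k : CocoSep.Hom Q.toCocoSep R.toCocoSep => k.toLVFunctor.toFun) h)

instance : (VModQuant.toCocoSepFunctor V).Full where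
  map_surjective f := ⟨VModQuant.Hom.ofCocontinuous f.cocontinuous, rfl⟩

instance : (VModQuant.toCocoSepFunctor V).EssSurj where
  mem_essImage X := ⟨X.toVModQuant, ⟨eqToIso X.toCocoSep_toVModQuant⟩⟩

instance : (VModQuant.toCocoSepFunctor V).IsEquivalence where

end QMulti

theorem mainTheorem1 (V : Type u) [CommMonoid V] [CompleteLattice V] [IsQuantale V] :
    Nonempty (QMulti.CocoSep V ≌ QMulti.VModQuant V) :=
  ⟨(QMulti.VModQuant.toCocoSepFunctor V).asEquivalence.symm⟩
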